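/- Let $m\ge 1$ be an integer and let $I^m=[0,1]^m\subset\mathbb{R}^m$, with the metric induced by $\|\cdot\|_\infty$ and with topological boundary $\partial I^m$ in $\mathbb{R}^m$. For a topological space $X$ let $\mathcal{C}(X)$ be the set of continuous maps $X\to X$, with the compact-open topology, and let $\mathcal{W}(2;X)=\{g\circ g : g\in\mathcal{C}(X)\}$. If $X$ is a compact metric space with metric $d$, this topology is induced by the supremum metric $\rho(f,g)=\sup_{x\in X}d(f(x),g(x))$; let $B_\epsilon(h)=\{f\in\mathcal{C}(X):\rho(f,h)<\epsilon\}$. Theorem. (a) Let $h\in\mathcal{C}(I^m)$ be such that $h(x_0)=x_0$ for some $x_0\in\partial I^m$. Then for each $\epsilon>0$ the ball $B_\epsilon(h)$ contains a map $f$ that has a continuous iterative square root on $I^m$, that is, $f=g\circ g$ for some $g\in\mathcal{C}(I^m)$. In other words, the closure of $\mathcal{W}(2;I^m)$ in $\mathcal{C}(I^m)$ contains all maps in $\mathcal{C}(I^m)$ that have a fixed point on the boundary of $I^m$. (b) The same holds for every space homeomorphic to $I^m$. Precisely, let $X$ be a topological space and $\varphi:X\to I^m$ a homeomorphism. Then every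 $h\in\mathcal{C}(X)$ with a fixed point in $\varphi^{-1}(\partial I^m)$ belongs to the closure of $\mathcal{W}(2;X)$ in $\mathcal{C}(X)$. If moreover the topology of $X$ is given by a metric, then for each $\epsilon>0$ the ball $B_\epsilon(h)$ contains a map $f=g\circ g$ with $g\in\mathcal{C}(X)$. -/

import Mathlib

/-- The unit cube `I^m = [0,1]^m` as a subset of `ℝ^m`; `Fin m → ℝ` carries the supremum norm. -/
def unitCubeSet (m : ℕ) : Set (Fin m → ℝ) := Set.Icc 0 1

/-- The unit cube `I^m` as a (compact metric) space. -/
abbrev UnitCube (m : ℕ) : Type := ↥(unitCubeSet m)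

instance unitCubeCompact (m : ℕ) : CompactSpace (UnitCube m) :=
  isCompact_iff_compactSpace.mp (isCompact_Icc : IsCompact (Set.Icc (0 : Fin m → ℝ) 1))

/-- The boundary `∂I^m` of the unit cube in `ℝ^m`, as a set of points of the cube. -/
def cubeBoundary (m : ℕ) : Set (UnitCube m) := {x | (x : Fin m → ℝ) ∈ frontier (unitCubeSet m)}

/-- `g` is an iterative root of order `n` of `f`: both are continuous self-maps of `X` and the
`n`-fold composition of `g` with itself is `f`. -/
def IsIterativeRoot {X : Type*} [TopologicalSpace X] (n : ℕ) (g f : C(X, X)) : Prop :=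
  ∀ x : X, (⇑g)^[n] x = f x

/-- `W(n; X)`: the set of `n`-th iterates of continuous self-maps of `X`. -/
def iterateSet (n : ℕ) (X : Type*) [TopologicalSpace X] : Set C(X, X) :=
  {f | ∃ g : C(X, X), IsIterativeRoot n g f}

open Metric

/-! Transfer to the unit ball and write `σ` for `smallCopy k x₀`. The root `G` shrinks most of the
ball into a tiny copy near `x₀` by `σ`, and on that copy applies `(1 - 5k) • H ∘ σ⁻¹`. Hence `G ∘ G
= (1 - 5k) • H` away from `x₀`. Near `x₀` the map `H` is close to `x₀`, so `G` may be interpolated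
there in any way that keeps `G ∘ G` close to `x₀`. The danger is the path joining the two regimes.
Since `σ` reflects, the radius going inward from `σ x₀` pulls back to the outward ray from `x₀`,
where the radially extended `H` is constantly `x₀`; this is where the boundary fixed point enters.
The estimate is `norm_approxRoot_approxRoot_sub_le`. -/

/-- The truncation of a real number to `[0,1]`. -/
noncomputable def clampUnit (t : ℝ) : ℝ := max 0 (min 1 t)

lemma continuous_clampUnit : Continuous clampUnit := by unfold clampUnit; fun_prop

lemma clampUnit_nonneg (t : ℝ) : 0 ≤ clampUnit t := le_max_left _ _

lemma clampUnit_le_one (t : ℝ) : clampUnit t ≤ 1 := max_le zero_le_one (min_le_left _ _)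

lemma clampUnit_of_nonpos {t : ℝ} (ht : t ≤ 0) : clampUnit t = 0 :=
  max_eq_left ((min_le_right _ _).trans ht)

lemma clampUnit_of_one_le {t : ℝ} (ht : 1 ≤ t) : clampUnit t = 1 := by
  simp [clampUnit, min_eq_left ht]

/-! ### Approximate square roots on the unit ball of a normed space. -/

section ApproximateRoot

variable {V : Type*} [NormedAddCommGroup V] [NormedSpace ℝ V]

/-- A small point-reflected copy of the unit ball inside itself, near the unit vector `x₀`. -/
noncomputable def smallCopy (k : ℝ) (x₀ u : V) : V := (1 - k) • x₀ - (k / 2) • (u - x₀)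

/-- The approximate square root of `H`. Far from `x₀` it is `smallCopy k x₀`; on the small copy it is
`(1 - 5k) • H` after undoing `smallCopy`; in between it runs along the radius through `x₀`. -/
noncomputable def approxRoot (k : ℝ) (x₀ : V) (H : V → V) (u : V) : V :=
  (1 - clampUnit (‖u - x₀‖ / k - 2)) • (1 - 5 * k) • H (x₀ - (2 / k) • (u - (1 - k) • x₀)) +
    clampUnit (‖u - x₀‖ / k - 2) • (1 - 5 * k) • x₀ +
    (clampUnit (‖u - x₀‖ / k - 3) * (4 * k)) • x₀ -
    (clampUnit (‖u - x₀‖ / k - 4) * (k / 2)) • (u - x₀)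

variable {k : ℝ} {x₀ : V} {H : V → V}

lemma continuous_approxRoot (hH : Continuous H) : Continuous (approxRoot k x₀ H) := by
  have := continuous_clampUnit
  unfold approxRoot
  fun_prop

lemma norm_smallCopy_sub_le (hk : 0 < k) (hx₀ : ‖x₀‖ = 1) {y : V} (hy : ‖y‖ ≤ 1) :
    ‖smallCopy k x₀ y - x₀‖ ≤ 2 * k := by
  have h1 : smallCopy k x₀ y - x₀ = -((k / 2) • x₀ + (k / 2) • y) := by
    unfold smallCopy; module
  rw [h1, norm_neg]
  refine (norm_add_le _ _).trans ?_
  rw [norm_smul, norm_smul, hx₀, Real.norm_of_nonneg (by positivity)]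
  nlinarith

lemma norm_smallCopy_le (hk : 0 < k) (hk1 : 5 * k < 1) (hx₀ : ‖x₀‖ = 1) {y : V} (hy : ‖y‖ ≤ 1) :
    ‖smallCopy k x₀ y‖ ≤ 1 := by
  have h1 : smallCopy k x₀ y = (1 - k / 2) • x₀ - (k / 2) • y := by
    unfold smallCopy; module
  rw [h1]
  refine (norm_sub_le _ _).trans ?_
  rw [norm_smul, norm_smul, hx₀, Real.norm_of_nonneg (by linarith), Real.norm_of_nonneg (by linarith)]
  nlinarith

lemma approxRoot_of_far (hk : 0 < k) {u : V} (hu : 4 * k ≤ ‖u - x₀‖) :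
    approxRoot k x₀ H u =
      smallCopy k x₀ (x₀ + clampUnit (‖u - x₀‖ / k - 4) • (u - x₀)) := by
  have h4 : 4 ≤ ‖u - x₀‖ / k := (le_div_iff₀ hk).2 hu
  unfold approxRoot smallCopy
  rw [clampUnit_of_one_le (t := ‖u - x₀‖ / k - 2) (by linarith),
    clampUnit_of_one_le (t := ‖u - x₀‖ / k - 3) (by linarith)]
  module

lemma approxRoot_of_very_far (hk : 0 < k) {u : V} (hu : 5 * k ≤ ‖u - x₀‖) :
    approxRoot k x₀ H u = smallCopy k x₀ u := by
  have h5 : 5 ≤ ‖u - x₀‖ / k := (le_div_iff₀ hk).2 hu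
  rw [approxRoot_of_far hk (by linarith), clampUnit_of_one_le (by linarith)]
  simp

lemma approxRoot_of_norm_le (hk : 0 < k) (hx₀ : ‖x₀‖ = 1) {u : V} (hu : ‖u‖ ≤ 1 - 5 * k) :
    approxRoot k x₀ H u = smallCopy k x₀ u := by
  refine approxRoot_of_very_far hk ?_
  have := norm_sub_norm_le x₀ u
  rw [norm_sub_rev] at this
  linarith

lemma approxRoot_smallCopy (hk : 0 < k) (hx₀ : ‖x₀‖ = 1) {y : V} (hy : ‖y‖ ≤ 1) :
    approxRoot k x₀ H (smallCopy k x₀ y) = (1 - 5 * k) • H y := by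
  have h2 : ‖smallCopy k x₀ y - x₀‖ / k ≤ 2 :=
    (div_le_iff₀ hk).2 (norm_smallCopy_sub_le hk hx₀ hy)
  have h3 : x₀ - (2 / k) • (smallCopy k x₀ y - (1 - k) • x₀) = y := by
    unfold smallCopy
    rw [sub_sub_cancel_left, smul_neg, smul_smul, show 2 / k * (k / 2) = 1 by field_simp]
    module
  unfold approxRoot
  rw [h3, clampUnit_of_nonpos (t := _ / k - 2) (by linarith),
    clampUnit_of_nonpos (t := _ / k - 3) (by linarith),
    clampUnit_of_nonpos (t := _ / k - 4) (by linarith)]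
  module

/-- The factor `1 - 5k` pushes these values at least `5k` away from `x₀`, so the second application
of the root is just `smallCopy`. -/
lemma norm_approxRoot_of_near (hk : 0 < k) (hk1 : 5 * k < 1) (hx₀ : ‖x₀‖ = 1)
    (hH : ∀ w, ‖H w‖ ≤ 1) {u : V} (hu : ‖u - x₀‖ ≤ 3 * k) :
    ‖approxRoot k x₀ H u‖ ≤ 1 - 5 * k := by
  have h3 : ‖u - x₀‖ / k ≤ 3 := (div_le_iff₀ hk).2 hu
  unfold approxRoot
  rw [clampUnit_of_nonpos (t := ‖u - x₀‖ / k - 3) (by linarith),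
    clampUnit_of_nonpos (t := ‖u - x₀‖ / k - 4) (by linarith)]
  generalize hs : clampUnit (‖u - x₀‖ / k - 2) = s
  have hs0 : 0 ≤ s := hs ▸ clampUnit_nonneg _
  have hs1 : s ≤ 1 := hs ▸ clampUnit_le_one _
  generalize x₀ - (2 / k) • (u - (1 - k) • x₀) = w
  have key : ‖(1 - s) • H w + s • x₀‖ ≤ 1 := by
    refine (norm_add_le _ _).trans ?_
    rw [norm_smul, norm_smul, hx₀, Real.norm_of_nonneg hs0, Real.norm_of_nonneg (by linarith)]
    nlinarith [hH w]
  have e : (1 - s) • (1 - 5 * k) • H w + s • (1 - 5 * k) • x₀ + (0 * (4 * k)) • x₀ -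
      (0 * (k / 2)) • (u - x₀) = (1 - 5 * k) • ((1 - s) • H w + s • x₀) := by module
  rw [e, norm_smul, Real.norm_of_nonneg (by linarith)]
  nlinarith

lemma approxRoot_of_middle (hk : 0 < k) {u : V}
    (hu : 3 * k ≤ ‖u - x₀‖) (hu' : ‖u - x₀‖ ≤ 4 * k) :
    ∃ t, k ≤ t ∧ t ≤ 5 * k ∧ approxRoot k x₀ H u = (1 - t) • x₀ := by
  have h3 : 3 ≤ ‖u - x₀‖ / k := (le_div_iff₀ hk).2 hu
  have h4 : ‖u - x₀‖ / k ≤ 4 := (div_le_iff₀ hk).2 hu'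
  unfold approxRoot
  rw [clampUnit_of_one_le (t := ‖u - x₀‖ / k - 2) (by linarith),
    clampUnit_of_nonpos (t := ‖u - x₀‖ / k - 4) (by linarith)]
  generalize hs : clampUnit (‖u - x₀‖ / k - 3) = s
  have hs0 : 0 ≤ s := hs ▸ clampUnit_nonneg _
  have hs1 : s ≤ 1 := hs ▸ clampUnit_le_one _
  exact ⟨5 * k - s * (4 * k), by nlinarith, by nlinarith, by module⟩

/-- Undoing `smallCopy` turns `(1 - t) • x₀` into a multiple of `x₀` by a factor at least `1`, so
`H` contributes exactly `x₀` and every term lies on the line through `x₀`. -/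
lemma norm_approxRoot_radius_sub_le (hk : 0 < k) (hk1 : 5 * k < 1) (hx₀ : ‖x₀‖ = 1)
    (hfix : ∀ t : ℝ, 1 ≤ t → H (t • x₀) = x₀) {t : ℝ} (ht : k ≤ t) (ht' : t ≤ 5 * k) :
    ‖approxRoot k x₀ H ((1 - t) • x₀) - x₀‖ ≤ 5 * k := by
  have h1 : x₀ - (2 / k) • ((1 - t) • x₀ - (1 - k) • x₀) = (1 + 2 / k * (t - k)) • x₀ := by
    module
  have h2 : 1 ≤ 1 + 2 / k * (t - k) := by
    have := mul_nonneg (div_nonneg zero_le_two hk.le) (sub_nonneg.2 ht)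
    linarith
  unfold approxRoot
  rw [h1, hfix _ h2]
  generalize clampUnit (_ / k - 2) = s
  generalize hs : clampUnit (_ / k - 3) = s₂
  generalize hs' : clampUnit (_ / k - 4) = s₃
  have h20 : 0 ≤ s₂ := hs ▸ clampUnit_nonneg _
  have h21 : s₂ ≤ 1 := hs ▸ clampUnit_le_one _
  have h30 : 0 ≤ s₃ := hs' ▸ clampUnit_nonneg _
  have h31 : s₃ ≤ 1 := hs' ▸ clampUnit_le_one _
  have e : (1 - s) • (1 - 5 * k) • x₀ + s • (1 - 5 * k) • x₀ + (s₂ * (4 * k)) • x₀ -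
      (s₃ * (k / 2)) • ((1 - t) • x₀ - x₀) - x₀ =
      (s₂ * (4 * k) + s₃ * (k / 2 * t) - 5 * k) • x₀ := by module
  rw [e, norm_smul, hx₀, mul_one, Real.norm_eq_abs, abs_le]
  have h4 : s₂ * (4 * k) ≤ 4 * k := by nlinarith
  have h5 : k / 2 * t ≤ k := by nlinarith
  have h6 : 0 ≤ k / 2 * t := by nlinarith
  have h7 : s₃ * (k / 2 * t) ≤ k / 2 * t := mul_le_of_le_one_left h6 h31
  have h8 : 0 ≤ s₂ * (4 * k) := by positivity
  have h9 : 0 ≤ s₃ * (k / 2 * t) := mul_nonneg h30 h6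
  constructor <;> linarith

lemma norm_add_clampUnit_smul_le (hx₀ : ‖x₀‖ = 1) {u : V} (hu : ‖u‖ ≤ 1) (t : ℝ) :
    ‖x₀ + clampUnit t • (u - x₀)‖ ≤ 1 := by
  generalize hs : clampUnit t = s
  have hs0 : 0 ≤ s := hs ▸ clampUnit_nonneg _
  have hs1 : s ≤ 1 := hs ▸ clampUnit_le_one _
  have e : x₀ + s • (u - x₀) = (1 - s) • x₀ + s • u := by module
  rw [e]
  refine (norm_add_le _ _).trans ?_
  rw [norm_smul, norm_smul, hx₀, Real.norm_of_nonneg hs0, Real.norm_of_nonneg (by linarith)]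
  nlinarith

lemma norm_approxRoot_le (hk : 0 < k) (hk1 : 5 * k < 1) (hx₀ : ‖x₀‖ = 1)
    (hH : ∀ w, ‖H w‖ ≤ 1) {u : V} (hu : ‖u‖ ≤ 1) : ‖approxRoot k x₀ H u‖ ≤ 1 := by
  rcases le_total ‖u - x₀‖ (3 * k) with h3 | h3
  · linarith [norm_approxRoot_of_near hk hk1 hx₀ hH h3]
  rcases le_total ‖u - x₀‖ (4 * k) with h4 | h4
  · obtain ⟨t, ht, ht', e⟩ := approxRoot_of_middle (H := H) hk h3 h4
    rw [e, norm_smul, hx₀, Real.norm_of_nonneg (by linarith)]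
    linarith
  · rw [approxRoot_of_far hk h4]
    exact norm_smallCopy_le hk hk1 hx₀ (norm_add_clampUnit_smul_le hx₀ hu _)

lemma norm_approxRoot_approxRoot_sub_le (hk : 0 < k) (hk1 : 5 * k < 1) (hx₀ : ‖x₀‖ = 1)
    (hH : ∀ w, ‖H w‖ ≤ 1) (hfix : ∀ t : ℝ, 1 ≤ t → H (t • x₀) = x₀) {δ : ℝ}
    (hδ : ∀ u, ‖u - x₀‖ ≤ 5 * k → ‖H u - x₀‖ ≤ δ) {u : V} (hu : ‖u‖ ≤ 1) :
    ‖approxRoot k x₀ H (approxRoot k x₀ H u) - H u‖ ≤ 5 * k + 2 * δ := by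
  have hδ0 : 0 ≤ δ := (norm_nonneg _).trans (hδ x₀ (by simpa using hk.le))
  have hr : ∀ y, ‖(1 - 5 * k) • H y - H y‖ ≤ 5 * k := fun y => by
    have e : (1 - 5 * k) • H y - H y = -((5 * k) • H y) := by module
    rw [e, norm_neg, norm_smul, Real.norm_of_nonneg (by positivity)]
    exact mul_le_of_le_one_right (by positivity) (hH y)
  rcases le_total (5 * k) ‖u - x₀‖ with h5 | h5
  · rw [approxRoot_of_very_far hk h5, approxRoot_smallCopy hk hx₀ hu]
    linarith [hr u]
  -- Within `5k` of `x₀`, `H u` is `δ`-close to `x₀`, so only closeness to `x₀` matters.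
  suffices h : ‖approxRoot k x₀ H (approxRoot k x₀ H u) - x₀‖ ≤ 5 * k + δ by
    have := norm_sub_le_norm_sub_add_norm_sub (approxRoot k x₀ H (approxRoot k x₀ H u)) x₀ (H u)
    rw [norm_sub_rev x₀] at this
    linarith [hδ u h5]
  rcases le_total ‖u - x₀‖ (3 * k) with h3 | h3
  · have hn := norm_approxRoot_of_near hk hk1 hx₀ hH h3
    rw [approxRoot_of_norm_le hk hx₀ hn]
    linarith [norm_smallCopy_sub_le hk hx₀ (hn.trans (by linarith))]
  rcases le_total ‖u - x₀‖ (4 * k) with h4 | h4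
  · obtain ⟨t, ht, ht', e⟩ := approxRoot_of_middle (H := H) hk h3 h4
    rw [e]
    linarith [norm_approxRoot_radius_sub_le hk hk1 hx₀ hfix ht ht']
  · rw [approxRoot_of_far hk h4,
      approxRoot_smallCopy hk hx₀ (norm_add_clampUnit_smul_le hx₀ hu _)]
    generalize hy : x₀ + clampUnit (‖u - x₀‖ / k - 4) • (u - x₀) = y
    have hyx : ‖y - x₀‖ ≤ 5 * k := by
      rw [← hy, add_sub_cancel_left, norm_smul, Real.norm_of_nonneg (clampUnit_nonneg _)]
      exact (mul_le_of_le_one_left (norm_nonneg _) (clampUnit_le_one _)).trans h5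
    have := norm_sub_le_norm_sub_add_norm_sub ((1 - 5 * k) • H y) (H y) x₀
    linarith [hr y, hδ y hyx]

lemma exists_approximate_square_root (hH : Continuous H) (hH1 : ∀ w, ‖H w‖ ≤ 1) (hx₀ : ‖x₀‖ = 1)
    (hfix : ∀ t : ℝ, 1 ≤ t → H (t • x₀) = x₀) {ε : ℝ} (hε : 0 < ε) :
    ∃ G : V → V, Continuous G ∧ (∀ u, ‖u‖ ≤ 1 → ‖G u‖ ≤ 1) ∧
      ∀ u, ‖u‖ ≤ 1 → ‖G (G u) - H u‖ < ε := by
  have h0 : H x₀ = x₀ := by simpa using hfix 1 le_rfl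
  obtain ⟨η, hη, hη'⟩ := Metric.continuousAt_iff.1 hH.continuousAt (ε / 4) (by positivity)
  obtain ⟨k, hk, hkm⟩ : ∃ k : ℝ, 0 < k ∧ 5 * k < min 1 (min η (ε / 4)) := by
    have : 0 < min 1 (min η (ε / 4)) := by positivity
    exact ⟨min 1 (min η (ε / 4)) / 6, by positivity, by linarith⟩
  rw [lt_min_iff, lt_min_iff] at hkm
  obtain ⟨hk1, hkη, hkε⟩ := hkm
  refine ⟨approxRoot k x₀ H, continuous_approxRoot hH,
    fun u hu => norm_approxRoot_le hk hk1 hx₀ hH1 hu, fun u hu => ?_⟩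
  -- Total error: `5k + 2δ < ε/4 + ε/2`.
  have := norm_approxRoot_approxRoot_sub_le hk hk1 hx₀ hH1 hfix (δ := ε / 4) (fun u hu => by
    have := hη' (x := u) (by rw [dist_eq_norm]; linarith)
    rw [h0, dist_eq_norm] at this
    exact this.le) hu
  linarith

/-- Radial retraction of a normed space onto its closed unit ball. -/
noncomputable def radialRetraction (V : Type*) [NormedAddCommGroup V] [NormedSpace ℝ V] :
    C(V, closedBall (0 : V) 1) where
  toFun w := ⟨(max 1 ‖w‖)⁻¹ • w, by
    have h : 0 < max 1 ‖w‖ := by positivity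
    rw [mem_closedBall_zero_iff, norm_smul, norm_inv, Real.norm_of_nonneg h.le, inv_mul_le_iff₀ h,
      mul_one]
    exact le_max_right _ _⟩
  continuous_toFun := by
    have : ∀ w : V, max 1 ‖w‖ ≠ 0 := fun w => by positivity
    fun_prop (disch := assumption)

lemma radialRetraction_coe (x : closedBall (0 : V) 1) : radialRetraction V x = x := by
  have : ‖(x : V)‖ ≤ 1 := mem_closedBall_zero_iff.1 x.2
  ext
  simp [radialRetraction, max_eq_left this]

/-- Makes the extended map constant on the outward ray from a fixed unit vector. -/
lemma radialRetraction_smul {x : closedBall (0 : V) 1} (hx : ‖(x : V)‖ = 1) {t : ℝ} (ht : 1 ≤ t) :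
    radialRetraction V (t • (x : V)) = x := by
  ext
  have h0 : 0 < t := by linarith
  simp [radialRetraction, norm_smul, hx, abs_of_pos h0, max_eq_right ht, smul_smul, h0.ne']

/-- A continuous self-map of the closed unit ball that fixes a unit vector is a limit of squares. -/
lemma mem_closure_iterateSet_closedBall [CompactSpace (closedBall (0 : V) 1)]
    (h : C(closedBall (0 : V) 1, closedBall (0 : V) 1)) {x : closedBall (0 : V) 1}
    (hx : ‖(x : V)‖ = 1) (hfix : h x = x) : h ∈ closure (iterateSet 2 (closedBall (0 : V) 1)) := by
  refine Metric.mem_closure_iff.2 fun ε hε => ?_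
  obtain ⟨G, hG, hG1, hGG⟩ := exists_approximate_square_root (x₀ := (x : V))
    (H := fun w => (h (radialRetraction V w) : V)) (by fun_prop)
    (fun w => mem_closedBall_zero_iff.1 (h (radialRetraction V w)).2) hx
    (fun t ht => by rw [radialRetraction_smul hx ht, hfix]) hε
  let g : C(closedBall (0 : V) 1, closedBall (0 : V) 1) :=
    ⟨fun u => ⟨G u, mem_closedBall_zero_iff.2 (hG1 u (mem_closedBall_zero_iff.1 u.2))⟩,
      by fun_prop⟩
  refine ⟨g.comp g, ⟨g, fun _ => rfl⟩, ?_⟩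
  rw [dist_comm, ContinuousMap.dist_lt_iff hε]
  intro u
  have := hGG u (mem_closedBall_zero_iff.1 u.2)
  rw [radialRetraction_coe] at this
  rw [Subtype.dist_eq, dist_eq_norm]
  exact this

end ApproximateRoot

/-! ### Transfer from the ball to the cube and its homeomorphic images. -/

/-- Being a limit of `n`-th iterates is invariant under conjugation by a homeomorphism. -/
lemma mem_closure_iterateSet_of_conj {X Y : Type*} [TopologicalSpace X] [TopologicalSpace Y]
    (e : X ≃ₜ Y) {n : ℕ} (h : C(X, X))
    (hh : (e : C(X, Y)).comp (h.comp (e.symm : C(Y, X))) ∈ closure (iterateSet n Y)) :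
    h ∈ closure (iterateSet n X) := by
  let c : C(Y, Y) → C(X, X) := fun f => (e.symm : C(Y, X)).comp (f.comp (e : C(X, Y)))
  have hc : Continuous c :=
    -- Continuity in the compact-open topology, so no metric on `X` is needed.
    (ContinuousMap.continuous_postcomp _).comp (ContinuousMap.continuous_precomp _)
  have hm : Set.MapsTo c (iterateSet n Y) (iterateSet n X) := by
    rintro f ⟨g, hg⟩
    refine ⟨c g, fun x => ?_⟩
    have hs : Function.Semiconj e (c g) g := fun x => by simp [c]
    apply e.injective
    rw [(hs.iterate_right n) x, hg]
    simp [c]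
  have := map_mem_closure hc hh hm
  convert this
  ext x
  simp [c]

lemma unitCubeSet_eq_closedBall (m : ℕ) :
    unitCubeSet m = closedBall (fun _ => (1 / 2 : ℝ)) (1 / 2) := by
  rw [unitCubeSet, ← Set.pi_univ_Icc, closedBall_pi _ (by norm_num)]
  simp only [Real.closedBall_eq_Icc]
  norm_num

lemma two_smul_sub_one_eq {m : ℕ} (x : Fin m → ℝ) :
    (2 : ℝ) • x - 1 = (2 : ℝ) • (x - fun _ => (1 / 2 : ℝ)) := by
  ext i
  simp
  ring

/-- The unit cube is the closed unit ball of the supremum norm, up to a dilation. -/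
noncomputable def unitCubeHomeomorph (m : ℕ) :
    UnitCube m ≃ₜ closedBall (0 : Fin m → ℝ) 1 :=
  ((Homeomorph.smulOfNeZero (2 : ℝ) two_ne_zero).trans
    (Homeomorph.subRight (1 : Fin m → ℝ))).subtype fun x => by
      change x ∈ unitCubeSet m ↔ (2 : ℝ) • x - 1 ∈ closedBall 0 1
      rw [unitCubeSet_eq_closedBall, mem_closedBall_iff_norm, mem_closedBall_zero_iff,
        two_smul_sub_one_eq, norm_smul, Real.norm_ofNat]
      constructor <;> intro h <;> linarith

lemma norm_unitCubeHomeomorph {m : ℕ} {x : UnitCube m} (hx : x ∈ cubeBoundary m) :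
    ‖(unitCubeHomeomorph m x : Fin m → ℝ)‖ = 1 := by
  have hx : ‖(x : Fin m → ℝ) - fun _ => (1 / 2 : ℝ)‖ = 1 / 2 := by
    rw [← mem_sphere_iff_norm, ← frontier_closedBall _ (by norm_num), ← unitCubeSet_eq_closedBall]
    exact hx
  change ‖(2 : ℝ) • (x : Fin m → ℝ) - 1‖ = 1
  rw [two_smul_sub_one_eq, norm_smul, hx]
  norm_num

lemma mem_closure_iterateSet_of_homeomorph_unitCube {m : ℕ} {X : Type*} [TopologicalSpace X]
    (φ : X ≃ₜ UnitCube m) (h : C(X, X)) {x₀ : X} (hx₀ : φ x₀ ∈ cubeBoundary m)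
    (hfix : h x₀ = x₀) : h ∈ closure (iterateSet 2 X) := by
  refine mem_closure_iterateSet_of_conj (φ.trans (unitCubeHomeomorph m)) h ?_
  refine mem_closure_iterateSet_closedBall _ (norm_unitCubeHomeomorph hx₀) ?_
  simp [hfix]

lemma exists_mem_ball_isIterativeRoot {X : Type*} [MetricSpace X] [CompactSpace X] {n : ℕ}
    {h : C(X, X)} (hh : h ∈ closure (iterateSet n X)) {ε : ℝ} (hε : 0 < ε) :
    ∃ f ∈ ball h ε, ∃ g : C(X, X), IsIterativeRoot n g f := by
  obtain ⟨f, hf, hd⟩ := Metric.mem_closure_iff.1 hh ε hε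
  exact ⟨f, mem_ball'.2 hd, hf⟩

theorem mainTheorem4 (m : ℕ) (hm : 0 < m) :
    (∀ (h : C(UnitCube m, UnitCube m)) (x₀ : UnitCube m), x₀ ∈ cubeBoundary m → h x₀ = x₀ →
      ∀ ε : ℝ, 0 < ε → ∃ f ∈ Metric.ball h ε, ∃ g : C(UnitCube m, UnitCube m),
        IsIterativeRoot 2 g f) ∧
    {h : C(UnitCube m, UnitCube m) | ∃ x₀ ∈ cubeBoundary m, h x₀ = x₀} ⊆
      closure (iterateSet 2 (UnitCube m)) ∧
    (∀ (X : Type*) [MetricSpace X] [CompactSpace X] (φ : X ≃ₜ UnitCube m) (h : C(X, X)) (x₀ : X),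
      φ x₀ ∈ cubeBoundary m → h x₀ = x₀ →
      ∀ ε : ℝ, 0 < ε → ∃ f ∈ Metric.ball h ε, ∃ g : C(X, X), IsIterativeRoot 2 g f) ∧
    (∀ (X : Type*) [TopologicalSpace X] (φ : X ≃ₜ UnitCube m),
      {h : C(X, X) | ∃ x₀ : X, φ x₀ ∈ cubeBoundary m ∧ h x₀ = x₀} ⊆ closure (iterateSet 2 X)) := by
  have key : ∀ (h : C(UnitCube m, UnitCube m)) (x₀ : UnitCube m), x₀ ∈ cubeBoundary m →
      h x₀ = x₀ → h ∈ closure (iterateSet 2 (UnitCube m)) := fun h x₀ hx₀ hfix =>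
    mem_closure_iterateSet_of_homeomorph_unitCube (Homeomorph.refl _) h (x₀ := x₀) hx₀ hfix
  refine ⟨fun h x₀ hx₀ hfix ε hε => exists_mem_ball_isIterativeRoot (key h x₀ hx₀ hfix) hε,
    ?_, fun X _ _ φ h x₀ hx₀ hfix ε hε => exists_mem_ball_isIterativeRoot
      (mem_closure_iterateSet_of_homeomorph_unitCube φ h hx₀ hfix) hε, ?_⟩
  · rintro h ⟨x₀, hx₀, hfix⟩
    exact key h x₀ hx₀ hfix
  · rintro X _ φ h ⟨x₀, hx₀, hfix⟩
    exact mem_closure_iterateSet_of_homeomorph_unitCube φ h hx₀ hfix
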